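/- For a partition $\lambda$ with Young diagram $D(\lambda)$ (row $i$, column $j$) and a filling $\boldsymbol k=(k_{i,j})$ of $D(\lambda)$ by positive integers, put $$\zeta^{M}_{\lambda}(\boldsymbol k)=\sum_{(t_{i,j})}\ \prod_{(i,j)\in D(\lambda)}t_{i,j}^{-k_{i,j}},$$ where the sum runs over the semistandard Young tableaux of shape $\lambda$ with entries in $\{1,\dots,M\}$ (rows weakly increasing, columns strictly increasing). Let $Z^{\ast}_{\lambda}(\boldsymbol k;T)\in\mathbb{R}[T]$ be the unique polynomial such that, for some $J>0$, $$\zeta^{M}_{\lambda}(\boldsymbol k)=Z^{\ast}_{\lambda}(\boldsymbol k;\log M+\gamma_{E})+O\!\left(\frac{\log^{J}M}{M}\right)\qquad(M\to\infty),$$ where $\gamma_E$ is Euler's constant, and let $\zeta^{\ast}_{\lambda}(\boldsymbol k):=Z^{\ast}_{\lambda}(\boldsymbol k;0)$ be the (stuffle) regularized Schur multiple zeta value. Let $\alpha,\beta,\gamma$ be positive integers, and let $a_c=\gamma$ for $c<0$, $a_0=\beta$, and $a_c=\alpha$ for $c>0$. For $m\in\mathbb{Z}$ and $p,q\ge 1$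 let $R^{(m)}_{p,q}:=\zeta^{\ast}_{(q^p)}\bigl((a_{m+j-i})_{1\le i\le p,\,1\le j\le q}\bigr)$, where $(q^p)$ is the rectangle with $p$ rows of length $q$, and put $R^{(m)}_{p,q}:=1$ if $p=0$ or $q=0$. Then the polynomials defining the values $R^{(m)}_{p,q}$ exist and are unique, and for all $p,q\ge 1$ and $m\in\mathbb{Z}$, $$R^{(m)}_{p,q+1}\,R^{(m+1)}_{p,q-1}=R^{(m)}_{p,q}\,R^{(m+1)}_{p,q}-R^{(m)}_{p-1,q}\,R^{(m+1)}_{p+1,q}.$$ -/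

import Mathlib

open Filter Asymptotics Polynomial

/-- The `p`-by-`q` rectangle `[p | q] = (q^p)`: `p` rows of `q` boxes. Boxes are indexed from `0`
as everywhere in Mathlib, which does not change the contents `j - i`. -/
def rectDiagram (p q : ℕ) : YoungDiagram where
  cells := Finset.range p ×ˢ Finset.range q
  isLowerSet := by
    rintro ⟨i, j⟩ ⟨i', j'⟩ ⟨h1, h2⟩ h
    simp only [Finset.coe_product, Finset.coe_range, Set.mem_prod, Set.mem_Iio] at h ⊢
    exact ⟨lt_of_le_of_lt h1 h.1, lt_of_le_of_lt h2 h.2⟩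

/-- A filling of the boxes `(i, j)` (row `i`, column `j`) of `lam` is semistandard if its rows are
weakly increasing and its columns are strictly increasing. -/
def IsSemistandard (lam : YoungDiagram) (t : lam.cells → ℕ) : Prop :=
  (∀ b b' : lam.cells, b.1.1 = b'.1.1 → b.1.2 < b'.1.2 → t b ≤ t b') ∧
  (∀ b b' : lam.cells, b.1.2 = b'.1.2 → b.1.1 < b'.1.1 → t b < t b')

open Classical in
/-- The semistandard Young tableaux of shape `lam` with entries in `{1, …, M}`. -/
noncomputable def ssyt (M : ℕ) (lam : YoungDiagram) : Finset (lam.cells → ℕ) :=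
  (Fintype.piFinset fun _ : lam.cells => Finset.Icc 1 M).filter (IsSemistandard lam)

/-- The `M`-truncated Schur multiple zeta value of shape `lam` at the integer tableau `k`
(only the values of `k` on the boxes of `lam` matter). -/
noncomputable def schurZetaTrunc (M : ℕ) (lam : YoungDiagram) (k : ℕ × ℕ → ℕ) : ℝ :=
  ∑ t ∈ ssyt M lam, ∏ b : lam.cells, ((t b : ℝ) ^ k b.1)⁻¹

/-- `P` describes the asymptotics of the truncated values: they equal
`P (log M + γ) + O((log M)^J / M)` for some `J > 0` as `M → ∞`, with `γ` Euler's constant. -/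
def IsSchurRegularization (lam : YoungDiagram) (k : ℕ × ℕ → ℕ) (P : ℝ[X]) : Prop :=
  ∃ J : ℕ, 0 < J ∧
    (fun M : ℕ => schurZetaTrunc M lam k -
        P.eval (Real.log M + Real.eulerMascheroniConstant))
      =O[atTop] (fun M : ℕ => Real.log M ^ J / (M : ℝ))

open Classical in
/-- The polynomial `Z^*_lam(k; T)`: the (unique) polynomial describing the asymptotics of the
truncated Schur multiple zeta values. -/
noncomputable def schurRegPoly (lam : YoungDiagram) (k : ℕ × ℕ → ℕ) : ℝ[X] :=
  if h : ∃ P : ℝ[X], IsSchurRegularization lam k P then h.choose else 0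

/-- The regularized Schur multiple zeta value `ζ^*_lam(k) = Z^*_lam(k; 0)`. -/
noncomputable def schurZetaReg (lam : YoungDiagram) (k : ℕ × ℕ → ℕ) : ℝ :=
  (schurRegPoly lam k).eval 0

/-- The diagonally constant tableau whose entry in the box `(i, j)` is `a_{j - i}`. -/
def diagTableau (a : ℤ → ℕ) : ℕ × ℕ → ℕ :=
  fun b => a ((b.2 : ℤ) - (b.1 : ℤ))

/-- The shift `τ^m a = (a_{c + m})_c`. -/
def shiftSeq (m : ℤ) (a : ℤ → ℕ) : ℤ → ℕ :=
  fun c => a (c + m)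

/-- The sequence with `a_c = γ` for `c < 0`, `a_0 = β` and `a_c = α` for `c > 0`. -/
def threeSeq (α β γ : ℕ) : ℤ → ℕ :=
  fun c => if c < 0 then γ else if c = 0 then β else α

/-- The regularized rectangular value `R^{(m)}_{p,q}(α, β, γ)`. -/
noncomputable def rectReg (α β γ : ℕ) (m : ℤ) (p q : ℕ) : ℝ :=
  if p = 0 ∨ q = 0 then 1
  else schurZetaReg (rectDiagram p q) (diagTableau (shiftSeq m (threeSeq α β γ)))

/-! At every finite level M the identity is already exact. A truncated value whose exponents depend
only on the content is a Jacobi–Trudi determinant (`schurZetaTrunc_rect`), with entries the one-row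
sums `rowSum` over an interval of contents. For the rectangle with p + 1 rows of length q, deleting
extreme rows and columns of this matrix yields the matrices of the five other rectangles, so the
Desnanot–Jacobi identity is the claim for truncated values (`jacobiTrudi_rect_desnanot_jacobi`).

Jacobi–Trudi is proved by induction on M: both sides obey the same recursion, a sum over the
horizontal strips that the entries M + 1 can occupy (`sum_bottomTableaux_succ`,
`det_jacobiTrudi_succ`).

To pass to regularized values, note that sequences of the form P(log M + γ) + O(log^J M / M) are
closed under sums and products, and under summation against t⁻ᵃ with a ≥ 1
(`HasLogExpansion.exists_of_sub_eq`). Hence row sums, and then their determinants, have expansions.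
As P is unique, the identity carries over to polynomials, and T = 0 gives the result. -/

/-! ### The Desnanot–Jacobi identity -/

namespace Matrix

/-- Jacobi's complementary minor formula: replace the second block column of the adjugate by that of
the identity, multiply by `A`, and take determinants of the two block triangular matrices. -/
theorem det_toBlocks₁₁_adjugate_mul_det {m n R : Type*} [Fintype m] [Fintype n] [DecidableEq m]
    [DecidableEq n] [CommRing R] (A : Matrix (m ⊕ n) (m ⊕ n) R) :
    A.det * A.adjugate.toBlocks₁₁.det = A.det ^ Fintype.card m * A.toBlocks₂₂.det := by
  have h : A * fromBlocks A.adjugate.toBlocks₁₁ 0 A.adjugate.toBlocks₂₁ 1 =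
      fromBlocks (A.det • 1) A.toBlocks₁₂ 0 A.toBlocks₂₂ := by
    have h1 : fromBlocks A.toBlocks₁₁ A.toBlocks₁₂ A.toBlocks₂₁ A.toBlocks₂₂ *
        fromBlocks A.adjugate.toBlocks₁₁ A.adjugate.toBlocks₁₂ A.adjugate.toBlocks₂₁
          A.adjugate.toBlocks₂₂ = A.det • fromBlocks 1 0 0 1 := by
      rw [fromBlocks_toBlocks, fromBlocks_toBlocks, fromBlocks_one, mul_adjugate]
    rw [fromBlocks_multiply, fromBlocks_smul, fromBlocks_inj] at h1
    conv_lhs => rw [← fromBlocks_toBlocks A]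
    rw [fromBlocks_multiply]
    simp only [fromBlocks_toBlocks, Matrix.mul_zero, Matrix.mul_one, zero_add]
    rw [h1.1, h1.2.2.1, smul_zero]
  have h2 := congrArg det h
  rwa [det_mul, det_fromBlocks_zero₁₂, det_fromBlocks_zero₂₁, det_one, mul_one, det_smul, det_one,
    mul_one] at h2

/-- The order on `Fin (n + 2)` in which the two extreme indices come first. -/
noncomputable def extremesEquiv (n : ℕ) : Fin 2 ⊕ Fin n ≃ Fin (n + 2) :=
  Equiv.ofBijective (Sum.elim ![0, Fin.last (n + 1)] fun i => i.castSucc.succ) <| by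
    rw [Fintype.bijective_iff_injective_and_card]
    refine ⟨?_, by simp [add_comm]⟩
    rintro (a | a) (b | b) h
    · fin_cases a <;> fin_cases b <;> simp_all [Fin.ext_iff]
    · have := b.2
      fin_cases a <;> simp_all [Fin.ext_iff]
      omega
    · have := a.2
      fin_cases b <;> simp_all [Fin.ext_iff]
      omega
    · simp_all [Fin.ext_iff]

theorem desnanot_jacobi_of_det_ne_zero {n : ℕ} {R : Type*} [CommRing R] [IsDomain R]
    (A : Matrix (Fin (n + 2)) (Fin (n + 2)) R) (hA : A.det ≠ 0) :
    A.det * (A.submatrix (fun i : Fin n => i.castSucc.succ) fun i => i.castSucc.succ).det =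
      (A.submatrix Fin.succ Fin.succ).det * (A.submatrix Fin.castSucc Fin.castSucc).det -
        (A.submatrix Fin.succ Fin.castSucc).det * (A.submatrix Fin.castSucc Fin.succ).det := by
  have h := det_toBlocks₁₁_adjugate_mul_det
    (A.submatrix (extremesEquiv n) (extremesEquiv n))
  rw [adjugate_submatrix_equiv_self, det_submatrix_equiv_self, Fintype.card_fin, sq, mul_assoc] at h
  have h1 := mul_left_cancel₀ hA h
  have e0 : extremesEquiv n (Sum.inl 0) = 0 := rfl
  have e1 : extremesEquiv n (Sum.inl 1) = Fin.last _ := rfl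
  have e2 : (A.submatrix (extremesEquiv n) (extremesEquiv n)).toBlocks₂₂ =
    A.submatrix (fun i : Fin n => i.castSucc.succ) fun i => i.castSucc.succ := rfl
  have s0 : Fin.succAbove (0 : Fin (n + 2)) = Fin.succ := Fin.succAbove_zero
  have s1 : Fin.succAbove (Fin.last (n + 1)) = Fin.castSucc := Fin.succAbove_last
  rw [e2, det_fin_two] at h1
  simp only [toBlocks₁₁, of_apply, submatrix_apply, e0, e1, adjugate_fin_succ_eq_det_submatrix,
    s0, s1] at h1
  rw [← h1]
  -- The cofactor signs of the two off-diagonal corners cancel in their product.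
  have hs : ((-1 : R) ^ (n + 1)) * (-1) ^ (n + 1) = 1 := by rw [← mul_pow]; simp
  simp only [Fin.val_zero, Fin.val_last, add_zero, zero_add, pow_zero, one_mul, pow_add]
  rw [pow_add] at hs
  linear_combination ((A.submatrix Fin.succ Fin.succ).det *
    (A.submatrix Fin.castSucc Fin.castSucc).det - (A.submatrix Fin.succ Fin.castSucc).det *
      (A.submatrix Fin.castSucc Fin.succ).det) * hs

/-- The Desnanot–Jacobi identity. -/
theorem desnanot_jacobi {n : ℕ} {R : Type*} [CommRing R] (A : Matrix (Fin (n + 2)) (Fin (n + 2)) R) :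
    A.det * (A.submatrix (fun i : Fin n => i.castSucc.succ) fun i => i.castSucc.succ).det =
      (A.submatrix Fin.succ Fin.succ).det * (A.submatrix Fin.castSucc Fin.castSucc).det -
        (A.submatrix Fin.succ Fin.castSucc).det * (A.submatrix Fin.castSucc Fin.succ).det := by
  -- The generic matrix over an integer polynomial ring has nonzero determinant; its identity
  -- specializes to any `A`.
  have h := congrArg (MvPolynomial.aeval (R := ℤ) fun ij : Fin (n + 2) × Fin (n + 2) => A ij.1 ij.2)
    (desnanot_jacobi_of_det_ne_zero _ (det_mvPolynomialX_ne_zero (Fin (n + 2)) ℤ))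
  simp only [map_mul, map_sub, AlgHom.map_det, AlgHom.mapMatrix_apply, ← submatrix_map] at h
  have hX : (mvPolynomialX (Fin (n + 2)) (Fin (n + 2)) ℤ).map
      (MvPolynomial.aeval (R := ℤ) fun ij : Fin (n + 2) × Fin (n + 2) => A ij.1 ij.2) = A :=
    mvPolynomialX_mapMatrix_aeval ℤ A
  rwa [hX] at h

end Matrix

/-! ### One-row sums -/

/-- Generating sum of weakly increasing words with letters `1, …, M` in positions `i, …, j - 1`,
the letter `t` in position `c` having weight `x t c`. -/
def rowSum {R : Type*} [CommRing R] (x : ℕ → ℕ → R) : ℕ → ℕ → ℕ → R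
  | 0, i, j => if i = j then 1 else 0
  | _ + 1, i, 0 => if i = 0 then 1 else 0
  | M + 1, i, j + 1 => rowSum x M i (j + 1) + x (M + 1) j * rowSum x (M + 1) i j

section rowSum

variable {R : Type*} [CommRing R] (x : ℕ → ℕ → R)

theorem rowSum_of_le (M : ℕ) {i j : ℕ} (h : j ≤ i) :
    rowSum x M i j = if i = j then 1 else 0 := by
  induction M generalizing j with
  | zero => rw [rowSum]
  | succ M ihM =>
    induction j with
    | zero => rw [rowSum]
    | succ j ihj =>
      rw [rowSum, ihM h, ihj (by omega), if_neg (show i ≠ j by omega), mul_zero, add_zero]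

/-- Classify words by the position `l` where the final run of letters M + 1 begins; the last term
collects the words in which this run covers all positions from `j` on. -/
theorem rowSum_succ_add (M i j n : ℕ) :
    rowSum x (M + 1) i (j + n) =
      ∑ l ∈ Finset.Ioc j (j + n), rowSum x M i l * ∏ c ∈ Finset.Ico l (j + n), x (M + 1) c +
        (∏ c ∈ Finset.Ico j (j + n), x (M + 1) c) * rowSum x (M + 1) i j := by
  induction n with
  | zero => simp
  | succ n ih =>
    rw [← add_assoc, rowSum, ih, Finset.prod_Ico_succ_top (by omega),
      ← Finset.insert_Ioc_right_eq_Ioc_add_one (show j ≤ j + n by omega),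
      Finset.sum_insert (by simp), Finset.Ico_self, Finset.prod_empty, mul_one, mul_add,
      Finset.mul_sum]
    have : ∀ l ∈ Finset.Ioc j (j + n), rowSum x M i l * ∏ c ∈ Finset.Ico l (j + n + 1), x (M + 1) c
        = x (M + 1) (j + n) * (rowSum x M i l * ∏ c ∈ Finset.Ico l (j + n), x (M + 1) c) := by
      intro l hl
      rw [Finset.prod_Ico_succ_top (Finset.mem_Ioc.1 hl).2]
      ring
    rw [Finset.sum_congr rfl this]
    ring

end rowSum

/-! ### Jacobi–Trudi determinants and horizontal strips -/

/-- The least length of row `k` in a shape obtained from row lengths `ν` by removing a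
horizontal strip; rows are listed from bottom to top. -/
def stripLower {p : ℕ} (ν : Fin p → ℕ) (k : Fin p) : ℕ :=
  if h : (k : ℕ) = 0 then 0 else ν ⟨k - 1, by omega⟩

/-- The row lengths that result from `ν` by removing a horizontal strip. -/
def strips {p : ℕ} (ν : Fin p → ℕ) : Finset (Fin p → ℕ) :=
  Fintype.piFinset fun k => Finset.Icc (stripLower ν k) (ν k)

/-- The Jacobi–Trudi matrix of the shape with row lengths `ν`, the lowest row of which starts at
the content `s`. -/
def jacobiTrudi {R : Type*} [CommRing R] (x : ℕ → ℕ → R) (M s : ℕ) {p : ℕ} (ν : Fin p → ℕ) :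
    Matrix (Fin p) (Fin p) R :=
  Matrix.of fun k k' => rowSum x M (s + k) (s + k' + ν k')

section jacobiTrudi

variable {R : Type*} [CommRing R] (x : ℕ → ℕ → R)

theorem det_jacobiTrudi_zero (s : ℕ) {p : ℕ} (ν : Fin p → ℕ) (hν : Monotone ν) :
    (jacobiTrudi x 0 s ν).det = if ν = 0 then 1 else 0 := by
  split_ifs with h
  · rw [show jacobiTrudi x 0 s ν = 1 from ?_, Matrix.det_one]
    ext k k'
    simp [jacobiTrudi, rowSum, h, Matrix.one_apply, Fin.ext_iff]
  · obtain ⟨k, hk⟩ := Function.ne_iff.1 h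
    obtain ⟨n, rfl⟩ : ∃ n, p = n + 1 := ⟨p - 1, by have := k.2; omega⟩
    -- By monotonicity the last row length is positive, so every interval in the last column is
    -- nonempty and carries no word over the empty alphabet.
    refine Matrix.det_eq_zero_of_column_eq_zero (Fin.last n) fun i => ?_
    have h1 := hν (Fin.le_last k)
    have h2 : 0 < ν k := Nat.pos_of_ne_zero hk
    have h3 := i.2
    simp only [jacobiTrudi, rowSum, Matrix.of_apply, Fin.val_last]
    rw [if_neg (by omega)]

theorem rowSum_succ_strip (M s : ℕ) {p : ℕ} (ν : Fin p → ℕ)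
    (k k' : Fin p) (hk : (k' : ℕ) = 0) :
    rowSum x (M + 1) (s + k) (s + k' + ν k') = ∑ l ∈ Finset.Icc (stripLower ν k') (ν k'),
      rowSum x M (s + k) (s + k' + l) * ∏ j ∈ Finset.Ico l (ν k'), x (M + 1) (s + k' + j) := by
  rw [rowSum_succ_add]
  rw [stripLower, dif_pos hk, hk, add_zero, ← Finset.Ioc_insert_left (Nat.zero_le _),
    Finset.sum_insert (by simp), add_comm, add_zero]
  congr 1
  · rw [rowSum_of_le _ _ (by omega), rowSum_of_le _ _ (by omega), Finset.prod_Ico_eq_prod_range,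
      Finset.prod_Ico_eq_prod_range]
    simp [mul_comm]
  · rw [show Finset.Ioc s (s + ν k') = (Finset.Ioc 0 (ν k')).map (addLeftEmbedding s) by simp,
      Finset.sum_map]
    refine Finset.sum_congr rfl fun l _ => ?_
    rw [Finset.prod_Ico_add]
    simp [add_comm]

/-- Cutting where the intervals of the previous column end leaves a remainder which is that column's
entry times a factor independent of `k`, so a column operation removes it. Consecutive columns are
offset by one content, which turns the open lower end of `Ioc` into the closed bound `stripLower`.
-/
theorem rowSum_succ_strip_succ (M s : ℕ) {p : ℕ} (ν : Fin (p + 1) → ℕ) (hν : Monotone ν)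
    (k : Fin (p + 1)) (i : Fin p) :
    rowSum x (M + 1) (s + k) (s + i.succ + ν i.succ) =
      ∑ l ∈ Finset.Icc (stripLower ν i.succ) (ν i.succ), rowSum x M (s + k) (s + i.succ + l) *
        ∏ j ∈ Finset.Ico l (ν i.succ), x (M + 1) (s + i.succ + j) +
      (∏ c ∈ Finset.Ico (s + i + ν i.castSucc) (s + i.succ + ν i.succ), x (M + 1) c) *
        rowSum x (M + 1) (s + k) (s + i + ν i.castSucc) := by
  have h1 := hν (Fin.castSucc_le_succ i)
  obtain ⟨n, hn⟩ : ∃ n, s + i.succ + ν i.succ = s + i + ν i.castSucc + n := by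
    simp only [Fin.val_succ]
    exact Nat.exists_eq_add_of_le (by omega)
  rw [hn, rowSum_succ_add, ← hn]
  congr 1
  have h2 : stripLower ν i.succ = ν i.castSucc := by
    simp [stripLower, Fin.castSucc, Fin.castAdd, Fin.castLE]
  rw [h2, show Finset.Ioc (s + i + ν i.castSucc) (s + i.succ + ν i.succ) =
    (Finset.Icc (ν i.castSucc) (ν i.succ)).map (addLeftEmbedding (s + i.succ)) from ?_,
      Finset.sum_map]
  · refine Finset.sum_congr rfl fun l _ => ?_
    rw [Finset.prod_Ico_add]
    simp [add_comm]
  · rw [Finset.map_add_left_Icc]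
    ext
    simp only [Finset.mem_Ioc, Finset.mem_Icc, Fin.val_succ]
    omega

theorem det_jacobiTrudi_succ (M s : ℕ) {p : ℕ} (ν : Fin p → ℕ) (hν : Monotone ν) :
    (jacobiTrudi x (M + 1) s ν).det = ∑ μ ∈ strips ν, (jacobiTrudi x M s μ).det *
      ∏ k, ∏ j ∈ Finset.Ico (μ k) (ν k), x (M + 1) (s + k + j) := by
  let B : Matrix (Fin p) (Fin p) R := Matrix.of fun k k' =>
    ∑ l ∈ Finset.Icc (stripLower ν k') (ν k'),
      rowSum x M (s + k) (s + k' + l) * ∏ j ∈ Finset.Ico l (ν k'), x (M + 1) (s + k' + j)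
  have h1 : (jacobiTrudi x (M + 1) s ν).det = B.det := by
    cases p with
    | zero => simp
    | succ p =>
      refine Matrix.det_eq_of_forall_col_eq_smul_add_pred (fun i =>
        ∏ c ∈ Finset.Ico (s + i + ν i.castSucc) (s + i.succ + ν i.succ), x (M + 1) c) ?_ ?_
      · intro k
        exact rowSum_succ_strip x M s ν k 0 rfl
      · intro k i
        exact rowSum_succ_strip_succ x M s ν hν k i
  let g : Fin p → ℕ → Fin p → R := fun k' l k =>
    rowSum x M (s + k) (s + k' + l) * ∏ j ∈ Finset.Ico l (ν k'), x (M + 1) (s + k' + j)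
  have h2 : B.det = Matrix.detRowAlternating
      (fun k' => ∑ l ∈ Finset.Icc (stripLower ν k') (ν k'), g k' l) := by
    rw [← Matrix.det_transpose]
    refine congrArg Matrix.det ?_
    ext k' k
    simp [B, g]
  rw [h1, h2]
  -- Multilinearity in the columns: choosing one summand per column amounts to choosing a strip `μ`.
  erw [MultilinearMap.map_sum_finset]
  refine Finset.sum_congr rfl fun μ _ => ?_
  rw [mul_comm, ← Matrix.det_mul_row, ← Matrix.det_transpose]
  refine congrArg Matrix.det ?_
  ext k' k
  simp [g, jacobiTrudi, mul_comm]

end jacobiTrudi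

/-! ### Tableaux and the Jacobi–Trudi formula -/

/-- Semistandard tableaux with `ν k` boxes in row `k`, rows being listed from bottom to top, and
entries in `{1, …, M}`; they are extended by zero to a rectangle. -/
structure IsBottomTableau (M : ℕ) {p q : ℕ} (ν : Fin p → ℕ) (t : Fin p × Fin q → ℕ) : Prop where
  pos : ∀ k (j : Fin q), (j : ℕ) < ν k → 1 ≤ t (k, j)
  le : ∀ k (j : Fin q), (j : ℕ) < ν k → t (k, j) ≤ M
  eq_zero : ∀ k (j : Fin q), ν k ≤ (j : ℕ) → t (k, j) = 0
  row : ∀ k (j j' : Fin q), j ≤ j' → (j' : ℕ) < ν k → t (k, j) ≤ t (k, j')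
  col : ∀ k k' (j : Fin q), k < k' → (j : ℕ) < ν k → t (k', j) < t (k, j)

open Classical in
/-- The finset of tableaux with row lengths `ν`, listed from bottom to top. -/
noncomputable def bottomTableaux (M : ℕ) {p : ℕ} (q : ℕ) (ν : Fin p → ℕ) :
    Finset (Fin p × Fin q → ℕ) :=
  (Fintype.piFinset fun _ => Finset.range (M + 1)).filter (IsBottomTableau M ν)

theorem mem_bottomTableaux {M p q : ℕ} {ν : Fin p → ℕ} {t : Fin p × Fin q → ℕ} :
    t ∈ bottomTableaux M q ν ↔ IsBottomTableau M ν t := by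
  simp only [bottomTableaux, Finset.mem_filter, Fintype.mem_piFinset, Finset.mem_range,
    and_iff_right_iff_imp]
  rintro h ⟨k, j⟩
  rcases lt_or_ge (j : ℕ) (ν k) with hj | hj
  · exact Nat.lt_succ_of_le (h.le k j hj)
  · simp [h.eq_zero k j hj]

/-- Extension of a tableau by a horizontal strip of entries `M + 1`. -/
def extendByStrip (M : ℕ) {p q : ℕ} (μ ν : Fin p → ℕ) (t : Fin p × Fin q → ℕ) :
    Fin p × Fin q → ℕ :=
  fun b => if (b.2 : ℕ) < μ b.1 then t b else if (b.2 : ℕ) < ν b.1 then M + 1 else 0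

theorem le_of_mem_strips {p : ℕ} {μ ν : Fin p → ℕ} (h : μ ∈ strips ν) (k : Fin p) : μ k ≤ ν k :=
  (Finset.mem_Icc.1 (Fintype.mem_piFinset.1 h k)).2

theorem le_of_mem_strips_of_lt {p : ℕ} {μ ν : Fin p → ℕ} (hν : Monotone ν) (h : μ ∈ strips ν)
    {k k' : Fin p} (hk : k < k') : ν k ≤ μ k' := by
  have h1 := (Finset.mem_Icc.1 (Fintype.mem_piFinset.1 h k')).1
  have hk' : (k : ℕ) < k' := hk
  rw [stripLower, dif_neg (by omega)] at h1
  refine le_trans (hν ?_) h1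
  rw [Fin.le_def]
  simp only
  omega

theorem monotone_of_mem_strips {p : ℕ} {μ ν : Fin p → ℕ} (hν : Monotone ν) (h : μ ∈ strips ν) :
    Monotone μ := by
  intro k k' hk
  rcases hk.eq_or_lt with rfl | hk
  · exact le_rfl
  · exact (le_of_mem_strips h k).trans (le_of_mem_strips_of_lt hν h hk)

theorem IsBottomTableau.extendByStrip {M p q : ℕ} {μ ν : Fin p → ℕ} {t : Fin p × Fin q → ℕ}
    (hν : Monotone ν) (hμ : μ ∈ strips ν) (ht : IsBottomTableau M μ t) :
    IsBottomTableau (M + 1) ν (extendByStrip M μ ν t) where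
  pos k j hj := by
    simp only [_root_.extendByStrip, hj, if_true]
    split_ifs with h
    · exact ht.pos k j h
    · omega
  le k j hj := by
    simp only [_root_.extendByStrip, hj, if_true]
    split_ifs with h
    · exact (ht.le k j h).trans (Nat.le_succ M)
    · omega
  eq_zero k j hj := by
    have := le_of_mem_strips hμ k
    simp only [_root_.extendByStrip]
    rw [if_neg (by omega), if_neg (by omega)]
  row k j j' hjj hj := by
    have hjj' : (j : ℕ) ≤ j' := hjj
    simp only [_root_.extendByStrip]
    by_cases h : (j' : ℕ) < μ k
    · rw [if_pos h, if_pos (by omega)]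
      exact ht.row k j j' hjj h
    · rw [if_neg h, if_pos hj]
      split_ifs with h1 h2
      · exact (ht.le k j h1).trans (Nat.le_succ M)
      · exact le_rfl
      · omega
  col k k' j hk hj := by
    have h1 := le_of_mem_strips_of_lt hν hμ hk
    have h2 : (j : ℕ) < μ k' := by omega
    simp only [_root_.extendByStrip]
    rw [if_pos h2, if_pos hj]
    split_ifs with h
    · exact ht.col k k' j hk h
    · exact Nat.lt_succ_of_le (ht.le k' j h2)

theorem exists_initial_segment (P : ℕ → Prop) (N : ℕ)
    (h : ∀ i j, i ≤ j → j < N → P j → P i) : ∃ m ≤ N, ∀ j < N, j < m ↔ P j := by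
  induction N with
  | zero => exact ⟨0, le_rfl, by simp⟩
  | succ N ih =>
    by_cases hN : P N
    · exact ⟨N + 1, le_rfl, fun j hj => ⟨fun _ => h j N (by omega) (by omega) hN, fun _ => hj⟩⟩
    · obtain ⟨m, hm, hm'⟩ := ih fun i j hi hj => h i j hi (by omega)
      refine ⟨m, by omega, fun j hj => ?_⟩
      rcases Nat.lt_succ_iff_lt_or_eq.1 hj with hj | rfl
      · exact hm' j hj
      · exact ⟨fun h => by omega, fun h => absurd h hN⟩

/-- The entries at most M form an initial segment of each row, of length `μ k`. Columns being
strict, no two entries M + 1 share a column, so what is removed is a horizontal strip. -/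
theorem IsBottomTableau.exists_eq_extendByStrip {M p q : ℕ} {ν : Fin p → ℕ}
    {t : Fin p × Fin q → ℕ} (hν : Monotone ν) (hq : ∀ k, ν k ≤ q)
    (ht : IsBottomTableau (M + 1) ν t) :
    ∃ μ ∈ strips ν, ∃ t' : Fin p × Fin q → ℕ, IsBottomTableau M μ t' ∧
      _root_.extendByStrip M μ ν t' = t := by
  have h : ∀ k, ∃ m ≤ ν k, ∀ j < ν k, j < m ↔ ∃ h : j < q, t (k, ⟨j, h⟩) ≤ M := by
    intro k
    refine exists_initial_segment _ _ ?_
    rintro i j hij hj ⟨h, h1⟩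
    exact ⟨by omega, (ht.row k _ ⟨j, h⟩ hij hj).trans h1⟩
  choose μ hμ hμ' using h
  have hlt : ∀ k (j : Fin q), (j : ℕ) < ν k → ((j : ℕ) < μ k ↔ t (k, j) ≤ M) := by
    intro k j hj
    rw [hμ' k j hj]
    exact ⟨fun h => h.2, fun h => ⟨j.2, h⟩⟩
  have hle : ∀ k (j : Fin q), (j : ℕ) < μ k → t (k, j) ≤ M := fun k j hj =>
    (hlt k j (hj.trans_le (hμ k))).1 hj
  refine ⟨μ, ?_, fun b => if (b.2 : ℕ) < μ b.1 then t b else 0, ?_, ?_⟩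
  · refine Fintype.mem_piFinset.2 fun k => Finset.mem_Icc.2 ⟨?_, hμ k⟩
    unfold stripLower
    split_ifs with hk
    · exact Nat.zero_le _
    -- Otherwise box `μ k` of row `k` has a box below it with entry at most M + 1; its own entry is
    -- then at most M, against the choice of `μ k`.
    · by_contra! hlow
      set k₀ : Fin p := ⟨k - 1, by omega⟩ with hk₀
      have hk₀k : k₀ < k := by
        rw [Fin.lt_def, hk₀]
        simp only
        omega
      have hj : μ k < q := hlow.trans_le (hq _)
      have h1 := ht.col k₀ k ⟨μ k, hj⟩ hk₀k hlow
      have h2 := ht.le k₀ ⟨μ k, hj⟩ hlow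
      have h3 := (hlt k ⟨μ k, hj⟩ (hlow.trans_le (hν hk₀k.le))).2 (by omega)
      exact lt_irrefl _ h3
  · constructor
    · intro k j hj
      simp only [hj, if_true]
      exact ht.pos k j (hj.trans_le (hμ k))
    · intro k j hj
      simp only [hj, if_true]
      exact hle k j hj
    · intro k j hj
      simp only
      rw [if_neg (by omega)]
    · intro k j j' hjj hj
      have hjj' : (j : ℕ) ≤ j' := hjj
      simp only
      rw [if_pos hj, if_pos (by omega)]
      exact ht.row k j j' hjj (hj.trans_le (hμ k))
    · intro k k' j hk hj
      have h1 := ht.col k k' j hk (hj.trans_le (hμ k))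
      simp only
      rw [if_pos hj]
      split_ifs
      · exact h1
      · omega
  · ext ⟨k, j⟩
    simp only [_root_.extendByStrip]
    split_ifs with h1 h2
    · rfl
    · have h3 := (hlt k j h2).not.1 h1
      have h4 := ht.le k j h2
      omega
    · exact (ht.eq_zero k j (by omega)).symm

theorem extendByStrip_injective {M p q : ℕ} {μ μ' ν : Fin p → ℕ} {t t' : Fin p × Fin q → ℕ}
    (hq : ∀ k, ν k ≤ q) (hμ : μ ∈ strips ν) (hμ' : μ' ∈ strips ν)
    (ht : IsBottomTableau M μ t) (ht' : IsBottomTableau M μ' t')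
    (h : extendByStrip M μ ν t = extendByStrip M μ' ν t') : μ = μ' ∧ t = t' := by
  -- If `μ k < μ' k`, box `μ k` of row `k` holds M + 1 in one extension and an entry at most M in
  -- the other.
  have key : ∀ {μ μ' : Fin p → ℕ} {t t' : Fin p × Fin q → ℕ}, μ' ∈ strips ν →
      IsBottomTableau M μ' t' → extendByStrip M μ ν t = extendByStrip M μ' ν t' →
      ∀ k, μ' k ≤ μ k := by
    intro μ μ' t t' hμ' ht' h k
    by_contra! hk
    have h1 := (le_of_mem_strips hμ' k)
    have h2 := congrFun h (k, ⟨μ k, by have := hq k; omega⟩)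
    simp only [extendByStrip, lt_irrefl, if_false] at h2
    rw [if_pos (by omega), if_pos hk] at h2
    have h3 := ht'.le k ⟨μ k, by have := hq k; omega⟩ hk
    omega
  have hμμ : μ = μ' := funext fun k => le_antisymm (key hμ ht h.symm k) (key hμ' ht' h k)
  refine ⟨hμμ, ?_⟩
  subst hμμ
  ext ⟨k, j⟩
  by_cases hj : (j : ℕ) < μ k
  · have h2 := congrFun h (k, j)
    simpa [extendByStrip, hj] using h2
  · rw [ht.eq_zero k j (by omega), ht'.eq_zero k j (by omega)]

section tableauSum

variable {R : Type*} [CommRing R] (x : ℕ → ℕ → R)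

/-- The weight of a tableau: the product of the `x t c` over its boxes of entry `t` and
content `c`, the lowest row starting at the content `s`. -/
def tableauWeight (s : ℕ) {p q : ℕ} (ν : Fin p → ℕ) (t : Fin p × Fin q → ℕ) : R :=
  ∏ b, if (b.2 : ℕ) < ν b.1 then x (t b) (s + b.1 + b.2) else 1

theorem tableauWeight_extendByStrip (M s : ℕ) {p q : ℕ} {μ ν : Fin p → ℕ} (hq : ∀ k, ν k ≤ q)
    (hμ : μ ∈ strips ν) (t : Fin p × Fin q → ℕ) :
    tableauWeight x s ν (extendByStrip M μ ν t) = tableauWeight x s μ t *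
      ∏ k, ∏ j ∈ Finset.Ico (μ k) (ν k), x (M + 1) (s + k + j) := by
  have h : ∀ k, ∏ j ∈ Finset.Ico (μ k) (ν k), x (M + 1) (s + k + j) =
      ∏ j : Fin q, if μ k ≤ j ∧ j < ν k then x (M + 1) (s + k + j) else 1 := by
    intro k
    rw [Fin.prod_univ_eq_prod_range
      (fun j => if μ k ≤ j ∧ j < ν k then x (M + 1) (s + k + j) else 1), ← Finset.prod_filter]
    refine Finset.prod_congr ?_ fun _ _ => rfl
    ext j
    have := hq k
    simp only [Finset.mem_Ico, Finset.mem_filter, Finset.mem_range]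
    omega
  simp_rw [h, tableauWeight]
  rw [← Fintype.prod_prod_type'
    (fun k (j : Fin q) => if μ k ≤ (j : ℕ) ∧ (j : ℕ) < ν k then x (M + 1) (s + k + j) else 1),
    ← Finset.prod_mul_distrib]
  refine Finset.prod_congr rfl fun b _ => ?_
  have h1 := le_of_mem_strips hμ b.1
  simp only [extendByStrip]
  by_cases h2 : (b.2 : ℕ) < μ b.1
  · rw [if_pos (by omega), if_pos h2, if_pos h2, if_neg (by omega), mul_one]
  · rw [if_neg h2, if_neg h2, one_mul]
    by_cases h3 : (b.2 : ℕ) < ν b.1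
    · rw [if_pos h3, if_pos h3, if_pos ⟨by omega, h3⟩]
    · rw [if_neg h3, if_neg (by omega)]

theorem sum_bottomTableaux_zero (s : ℕ) {p : ℕ} (q : ℕ) (ν : Fin p → ℕ) (hq : ∀ k, ν k ≤ q) :
    ∑ t ∈ bottomTableaux 0 q ν, tableauWeight x s ν t = if ν = 0 then 1 else 0 := by
  split_ifs with h
  · subst h
    have : bottomTableaux 0 q (0 : Fin p → ℕ) = {0} := by
      ext t
      rw [mem_bottomTableaux, Finset.mem_singleton]
      constructor
      · intro h
        ext ⟨k, j⟩
        exact h.eq_zero k j (Nat.zero_le _)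
      · rintro rfl
        constructor <;> simp
    rw [this, Finset.sum_singleton]
    simp [tableauWeight]
  · obtain ⟨k, hk⟩ := Function.ne_iff.1 h
    have h2 : 0 < ν k := Nat.pos_of_ne_zero hk
    refine Finset.sum_eq_zero fun t ht => ?_
    rw [mem_bottomTableaux] at ht
    have h3 := ht.pos k ⟨0, h2.trans_le (hq k)⟩ h2
    have h4 := ht.le k ⟨0, h2.trans_le (hq k)⟩ h2
    omega

theorem sum_bottomTableaux_succ (M s : ℕ) {p : ℕ} (q : ℕ) (ν : Fin p → ℕ) (hν : Monotone ν)
    (hq : ∀ k, ν k ≤ q) :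
    ∑ t ∈ bottomTableaux (M + 1) q ν, tableauWeight x s ν t =
      ∑ μ ∈ strips ν, (∑ t ∈ bottomTableaux M q μ, tableauWeight x s μ t) *
        ∏ k, ∏ j ∈ Finset.Ico (μ k) (ν k), x (M + 1) (s + k + j) := by
  simp_rw [Finset.sum_mul]
  rw [Finset.sum_sigma']
  symm
  refine Finset.sum_bij (fun a _ => extendByStrip M a.1 ν a.2) ?_ ?_ ?_ ?_
  · rintro ⟨μ, t⟩ h
    simp only [Finset.mem_sigma, mem_bottomTableaux] at h ⊢
    exact h.2.extendByStrip hν h.1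
  · rintro ⟨μ, t⟩ h ⟨μ', t'⟩ h' he
    simp only [Finset.mem_sigma, mem_bottomTableaux] at h h'
    obtain ⟨rfl, rfl⟩ := extendByStrip_injective hq h.1 h'.1 h.2 h'.2 he
    rfl
  · intro t ht
    obtain ⟨μ, hμ, t', ht', he⟩ :=
      (mem_bottomTableaux.1 ht).exists_eq_extendByStrip hν hq
    exact ⟨⟨μ, t'⟩, Finset.mem_sigma.2 ⟨hμ, mem_bottomTableaux.2 ht'⟩, he⟩
  · rintro ⟨μ, t⟩ h
    exact (tableauWeight_extendByStrip x M s hq (Finset.mem_sigma.1 h).1 t).symm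

/-- The Jacobi–Trudi formula for content-dependent weights. -/
theorem sum_bottomTableaux_eq_det (M s : ℕ) {p : ℕ} (q : ℕ) (ν : Fin p → ℕ) (hν : Monotone ν)
    (hq : ∀ k, ν k ≤ q) :
    ∑ t ∈ bottomTableaux M q ν, tableauWeight x s ν t = (jacobiTrudi x M s ν).det := by
  induction M generalizing ν with
  | zero => rw [sum_bottomTableaux_zero x s q ν hq, det_jacobiTrudi_zero x s ν hν]
  | succ M ih =>
    rw [sum_bottomTableaux_succ x M s q ν hν hq, det_jacobiTrudi_succ x M s ν hν]
    refine Finset.sum_congr rfl fun μ hμ => ?_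
    rw [ih μ (monotone_of_mem_strips hν hμ) fun k => (le_of_mem_strips hμ k).trans (hq k)]

end tableauSum

/-! ### Truncated values of rectangles -/

/-- The boxes of a rectangle, with the rows listed from bottom to top. -/
def rectCellsEquiv (p q : ℕ) : (rectDiagram p q).cells ≃ Fin p × Fin q where
  toFun b := (Fin.rev ⟨b.1.1, Finset.mem_range.1 (Finset.mem_product.1 b.2).1⟩,
    ⟨b.1.2, Finset.mem_range.1 (Finset.mem_product.1 b.2).2⟩)
  invFun c := ⟨((Fin.rev c.1 : ℕ), (c.2 : ℕ)), Finset.mem_product.2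
    ⟨Finset.mem_range.2 (Fin.rev c.1).2, Finset.mem_range.2 c.2.2⟩⟩
  left_inv b := by
    apply Subtype.ext
    simp
  right_inv c := by
    refine Prod.ext (Fin.ext ?_) rfl
    have := c.1.2
    simp only [Fin.val_rev]
    omega

theorem mem_ssyt_rect_iff {M p q : ℕ} (t : (rectDiagram p q).cells → ℕ) :
    t ∈ ssyt M (rectDiagram p q) ↔
      t ∘ (rectCellsEquiv p q).symm ∈ bottomTableaux M q (fun _ : Fin p => q) := by
  rw [mem_bottomTableaux, ssyt, @Finset.mem_filter, Fintype.mem_piFinset]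
  simp only [Finset.mem_Icc]
  constructor
  · rintro ⟨h, h1, h2⟩
    refine ⟨fun k j _ => (h _).1, fun k j _ => (h _).2, fun k j hj => absurd j.2 (by omega), ?_, ?_⟩
    · intro k j j' hj _
      rcases hj.eq_or_lt with rfl | hj
      · exact le_rfl
      · exact h1 _ _ rfl hj
    · intro k k' j hk _
      exact h2 _ _ rfl (Fin.rev_lt_rev.2 hk)
  · intro h
    have ht : ∀ b, t b = (t ∘ (rectCellsEquiv p q).symm) (rectCellsEquiv p q b) := by simp
    refine ⟨fun b => ?_, fun b b' hb hb' => ?_, fun b b' hb hb' => ?_⟩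
    · rw [ht]
      exact ⟨h.pos _ _ (Fin.is_lt _), h.le _ _ (Fin.is_lt _)⟩
    · rw [ht b, ht b']
      have e : rectCellsEquiv p q b = ((rectCellsEquiv p q b').1, (rectCellsEquiv p q b).2) := by
        simp [rectCellsEquiv, hb]
      rw [e]
      exact h.row _ _ _ (Fin.le_def.2 hb'.le) (Fin.is_lt _)
    · rw [ht b, ht b']
      have e : rectCellsEquiv p q b = ((rectCellsEquiv p q b).1, (rectCellsEquiv p q b').2) := by
        simp [rectCellsEquiv, hb]
      rw [e]
      exact h.col _ _ _ (Fin.rev_lt_rev.2 hb') (Fin.is_lt _)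

/-- The Jacobi–Trudi formula for truncated Schur multiple zeta values of rectangles. -/
theorem schurZetaTrunc_rect (M p q s : ℕ) (k : ℕ × ℕ → ℕ) (a : ℕ → ℕ)
    (h : ∀ i j, i < p → j < q → k (i, j) = a (s + (p - 1 - i) + j)) :
    schurZetaTrunc M (rectDiagram p q) k =
      (jacobiTrudi (fun t c => ((t : ℝ) ^ a c)⁻¹) M s (fun _ : Fin p => q)).det := by
  rw [← sum_bottomTableaux_eq_det _ M s q _ monotone_const fun _ => le_rfl, schurZetaTrunc]
  refine Finset.sum_equiv (Equiv.arrowCongr (rectCellsEquiv p q) (Equiv.refl ℕ))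
    (fun t => mem_ssyt_rect_iff t) fun t _ => ?_
  rw [tableauWeight]
  refine Fintype.prod_equiv (rectCellsEquiv p q) _ _ fun b => ?_
  have hb := Finset.mem_product.1 b.2
  rw [if_pos (Fin.is_lt _), show b.1 = (b.1.1, b.1.2) from rfl,
    h _ _ (Finset.mem_range.1 hb.1) (Finset.mem_range.1 hb.2)]
  simp only [Equiv.arrowCongr_apply, Function.comp_apply, Equiv.symm_apply_apply,
    Equiv.refl_apply]
  simp only [rectCellsEquiv, Equiv.coe_fn_mk, Fin.val_rev]
  rw [show p - (b.1.1 + 1) = p - 1 - b.1.1 by omega]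

/-! ### Error terms with logarithms -/

/-- `f` is `O((log M)^J / M^k)` for some `J`. -/
def IsLogSmall (k : ℕ) (f : ℕ → ℝ) : Prop :=
  ∃ J : ℕ, f =O[atTop] fun M : ℕ => Real.log M ^ J / (M : ℝ) ^ k

theorem eventually_one_le_log_natCast : ∀ᶠ M : ℕ in atTop, 1 ≤ Real.log M :=
  (Real.tendsto_log_atTop.comp tendsto_natCast_atTop_atTop).eventually_ge_atTop 1

theorem isBigO_log_pow_div {J J' : ℕ} (h : J ≤ J') (k : ℕ) :
    (fun M : ℕ => Real.log M ^ J / (M : ℝ) ^ k) =O[atTop]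
      fun M : ℕ => Real.log M ^ J' / (M : ℝ) ^ k := by
  refine IsBigO.of_bound 1 ?_
  filter_upwards [eventually_one_le_log_natCast] with M hM
  have h0 : (0 : ℝ) ≤ Real.log M := by linarith
  rw [one_mul, Real.norm_of_nonneg (by positivity), Real.norm_of_nonneg (by positivity)]
  gcongr

namespace IsLogSmall

variable {k l : ℕ} {f g : ℕ → ℝ}

theorem add (hf : IsLogSmall k f) (hg : IsLogSmall k g) : IsLogSmall k fun M => f M + g M := by
  obtain ⟨J, hJ⟩ := hf
  obtain ⟨J', hJ'⟩ := hg
  exact ⟨max J J', (hJ.trans (isBigO_log_pow_div (le_max_left _ _) k)).add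
    (hJ'.trans (isBigO_log_pow_div (le_max_right _ _) k))⟩

theorem neg (hf : IsLogSmall k f) : IsLogSmall k fun M => -f M := by
  obtain ⟨J, hJ⟩ := hf
  exact ⟨J, hJ.neg_left⟩

theorem sub (hf : IsLogSmall k f) (hg : IsLogSmall k g) : IsLogSmall k fun M => f M - g M := by
  simpa only [sub_eq_add_neg] using hf.add hg.neg

theorem mul (hf : IsLogSmall k f) (hg : IsLogSmall l g) :
    IsLogSmall (k + l) fun M => f M * g M := by
  obtain ⟨J, hJ⟩ := hf
  obtain ⟨J', hJ'⟩ := hg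
  refine ⟨J + J', (hJ.mul hJ').congr_right fun M => ?_⟩
  rw [div_mul_div_comm, pow_add, pow_add]

theorem mono (h : k ≤ l) (hf : IsLogSmall l f) : IsLogSmall k f := by
  obtain ⟨J, hJ⟩ := hf
  refine ⟨J, hJ.trans (IsBigO.of_bound 1 ?_)⟩
  filter_upwards [eventually_one_le_log_natCast, eventually_ge_atTop 1] with M hM hM1
  have h0 : (0 : ℝ) ≤ Real.log M := by linarith
  have h1 : (1 : ℝ) ≤ M := by exact_mod_cast hM1
  rw [one_mul, Real.norm_of_nonneg (by positivity), Real.norm_of_nonneg (by positivity)]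
  gcongr

theorem const (c : ℝ) : IsLogSmall 0 fun _ => c :=
  ⟨0, by simpa using isBigO_const_const c (one_ne_zero (α := ℝ)) (atTop : Filter ℕ)⟩

theorem log : IsLogSmall 0 fun M => Real.log M :=
  ⟨1, by simpa using isBigO_refl _ _⟩

theorem inv_pow (k : ℕ) : IsLogSmall k fun M => ((M : ℝ) ^ k)⁻¹ :=
  ⟨0, by simpa using isBigO_refl _ _⟩

theorem zero (k : ℕ) : IsLogSmall k fun _ => 0 := ⟨0, isBigO_zero _ _⟩

theorem congr' (h : IsLogSmall k f) (hfg : f =ᶠ[atTop] g) : IsLogSmall k g := by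
  obtain ⟨J, hJ⟩ := h
  exact ⟨J, hJ.congr' hfg EventuallyEq.rfl⟩

theorem eval (hf : IsLogSmall 0 f) (P : ℝ[X]) : IsLogSmall 0 fun M => P.eval (f M) := by
  induction P using Polynomial.induction_on' with
  | add P Q hP hQ => simpa using hP.add hQ
  | monomial n a =>
    simp only [eval_monomial]
    refine (const a).mul (k := 0) (l := 0) ?_
    induction n with
    | zero => simpa using const 1
    | succ n ih => simpa only [pow_succ] using ih.mul (l := 0) hf

/-- First-order Taylor expansion of a polynomial. -/
theorem eval_sub_eval_sub {u h : ℕ → ℝ} (hu : IsLogSmall 0 u) (hh : IsLogSmall 1 h) (Q : ℝ[X]) :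
    IsLogSmall 2 fun M => Q.eval (u M) - Q.eval (u M - h M) - h M * Q.derivative.eval (u M) := by
  induction Q using Polynomial.induction_on with
  | C a => simpa using zero 2
  | add P Q hP hQ =>
    refine (hP.add hQ).congr' (Eventually.of_forall fun M => ?_)
    simp only [eval_add, derivative_add]
    ring
  | monomial n a ih =>
    set Q : ℝ[X] := C a * X ^ n with hQ
    have h1 : IsLogSmall 1 fun M => (Q.eval (u M) - Q.eval (u M - h M) -
        h M * Q.derivative.eval (u M)) + h M * Q.derivative.eval (u M) :=
      (ih.mono one_le_two).add (hh.mul (l := 0) (hu.eval _))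
    -- With D(Q) the Taylor remainder, D(Q·X) = u·D(Q) − h·(Q(u) − Q(u − h)), and `h1` bounds the
    -- last difference to first order.
    refine ((hu.mul (l := 2) ih).sub (hh.mul (l := 1) h1)).congr'
      (Eventually.of_forall fun M => ?_)
    rw [pow_succ, ← mul_assoc, ← hQ]
    simp only [derivative_mul, derivative_X, eval_add, eval_mul, eval_X, eval_one]
    ring

theorem log_sub_log_sub_inv : IsLogSmall 2 fun M : ℕ =>
    Real.log M - Real.log ((M : ℝ) - 1) - (M : ℝ)⁻¹ := by
  refine ⟨0, IsBigO.of_bound 2 ?_⟩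
  filter_upwards [eventually_ge_atTop 2] with M hM
  have hM' : (2 : ℝ) ≤ M := by exact_mod_cast hM
  have h0 : (0 : ℝ) < M := by linarith
  have h1 : (0 : ℝ) < (M : ℝ) - 1 := by linarith
  have e : Real.log M - Real.log ((M : ℝ) - 1) = Real.log (M / ((M : ℝ) - 1)) := by
    rw [Real.log_div h0.ne' h1.ne']
  -- The bounds 1 − 1/y ≤ log y ≤ y − 1 at y = M/(M − 1) enclose the logarithm between 1/M and 1/(M
  -- − 1).
  have l1 := Real.one_sub_inv_le_log_of_pos (div_pos h0 h1)
  have l2 := Real.log_le_sub_one_of_pos (div_pos h0 h1)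
  have e1 : 1 - ((M : ℝ) / ((M : ℝ) - 1))⁻¹ = (M : ℝ)⁻¹ := by
    field_simp
    ring
  have e2 : (M : ℝ) / ((M : ℝ) - 1) - 1 = ((M : ℝ) - 1)⁻¹ := by
    field_simp
    ring
  rw [e1] at l1
  rw [e2] at l2
  rw [e, Real.norm_of_nonneg (by linarith), pow_zero, Real.norm_of_nonneg (by positivity)]
  have e3 : ((M : ℝ) - 1)⁻¹ - (M : ℝ)⁻¹ ≤ 2 * (1 / (M : ℝ) ^ 2) := by
    rw [inv_sub_inv h1.ne' h0.ne', mul_one_div, div_le_div_iff₀ (by positivity) (by positivity)]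
    nlinarith
  linarith

theorem log_sub_log : IsLogSmall 1 fun M : ℕ => Real.log M - Real.log ((M : ℝ) - 1) := by
  refine ((log_sub_log_sub_inv.mono one_le_two).add (inv_pow 1)).congr'
    (Eventually.of_forall fun M => ?_)
  simp

end IsLogSmall

/-! ### Summation of error terms -/

theorem antitoneOn_log_pow_div_sqrt (J : ℕ) :
    ∃ N : ℝ, AntitoneOn (fun y : ℝ => Real.log y ^ J / √y) (Set.Ici N) := by
  rcases Nat.eq_zero_or_pos J with rfl | hJ
  · refine ⟨1, fun y hy z _ hyz => ?_⟩
    have : (1 : ℝ) ≤ y := hy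
    simp only [pow_zero]
    have h0 : (0 : ℝ) < √y := Real.sqrt_pos.2 (by linarith)
    gcongr
  · have hJ' : (0 : ℝ) < J := by exact_mod_cast hJ
    have ha : (0 : ℝ) < (2 * J : ℝ)⁻¹ := by positivity
    refine ⟨Real.exp ((2 * J : ℝ)⁻¹)⁻¹, fun y hy z hz hyz => ?_⟩
    have h := Real.log_div_self_rpow_antitoneOn ha hy hz hyz
    have pos : ∀ w ∈ Set.Ici (Real.exp ((2 * J : ℝ)⁻¹)⁻¹), 1 ≤ w := fun w hw =>
      (Real.one_le_exp (by positivity)).trans hw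
    have e : ∀ w ∈ Set.Ici (Real.exp ((2 * J : ℝ)⁻¹)⁻¹), Real.log w ^ J / √w =
        (Real.log w / w ^ (2 * J : ℝ)⁻¹) ^ J := by
      intro w hw
      have := pos w hw
      rw [div_pow, ← Real.rpow_mul_natCast (by linarith), Real.sqrt_eq_rpow]
      congr 2
      field_simp
    simp only
    rw [e y hy, e z hz]
    have := pos z hz
    have := Real.log_nonneg this
    exact pow_le_pow_left₀ (by positivity) h J

/-- Telescoping majorant for the error terms. Half a power of M absorbs the growth of log^J, since
log^J y / √y eventually decreases; the other half supplies the gain. With r = √M and s = √(M + 1),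
the factor 2 is enough because 2s(s − r) ≥ (s + r)(s − r) = 1. -/
theorem eventually_log_pow_div_sq_le (J : ℕ) : ∀ᶠ M : ℕ in atTop,
    Real.log (M + 1 : ℕ) ^ J / ((M + 1 : ℕ) : ℝ) ^ 2 ≤
      2 * (Real.log M ^ J / (M : ℝ) - Real.log (M + 1 : ℕ) ^ J / ((M + 1 : ℕ) : ℝ)) := by
  obtain ⟨N, hN⟩ := antitoneOn_log_pow_div_sqrt J
  filter_upwards [tendsto_natCast_atTop_atTop.eventually_ge_atTop N, eventually_ge_atTop 1]
    with M h1 h2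
  have h3 : (1 : ℝ) ≤ M := by exact_mod_cast h2
  have h := hN (a := (M : ℝ)) h1 (b := (M : ℝ) + 1)
    (Set.mem_Ici.2 (le_trans h1 (by linarith))) (by linarith)
  simp only at h
  push_cast
  set a := Real.log M ^ J
  set b := Real.log (M + 1 : ℝ) ^ J
  have hb : 0 ≤ b := pow_nonneg (Real.log_nonneg (by linarith)) J
  set r := √(M : ℝ) with hr
  set s := √((M : ℝ) + 1) with hs
  have hr0 : 0 < r := Real.sqrt_pos.2 (by linarith)
  have hrs : r ≤ s := Real.sqrt_le_sqrt (by linarith)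
  have hs0 : 0 < s := hr0.trans_le hrs
  have hr2 : (M : ℝ) = r * r := (Real.mul_self_sqrt (by linarith)).symm
  have hs2 : (M : ℝ) + 1 = s * s := (Real.mul_self_sqrt (by linarith)).symm
  have hd : s * s - r * r = 1 := by linarith
  rw [hs2, hr2]
  have k1 : b / s / r ≤ a / (r * r) := by
    rw [← div_div]
    gcongr
  have k2 : b / (s * s) ^ 2 ≤ 2 * (b / s / r - b / (s * s)) := by
    have e : 2 * (b / s / r - b / (s * s)) - b / (s * s) ^ 2 =
        b * (2 * (s - r) * s ^ 2 - r) / (r * s ^ 4) := by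
      field_simp
    have e2 : 0 ≤ 2 * (s - r) * s ^ 2 - r := by
      have : (s - r) * (s + r) = 1 := by linarith
      have h4 : 1 ≤ (s - r) * (2 * s) := by nlinarith
      nlinarith
    have : 0 ≤ b * (2 * (s - r) * s ^ 2 - r) / (r * s ^ 4) := by positivity
    linarith
  linarith

/-- From `N` on, g − B increases and g + B decreases, and they enclose a common limit `c`; this
gives convergence and its rate at once. -/
theorem exists_abs_sub_le_of_abs_sub_le {g B : ℕ → ℝ} (hB : Tendsto B atTop (nhds 0)) {N : ℕ}
    (h : ∀ M ≥ N, |g (M + 1) - g M| ≤ B M - B (M + 1)) : ∃ c, ∀ M ≥ N, |g M - c| ≤ B M := by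
  have h1 : Monotone fun n => g (n + N) - B (n + N) := monotone_nat_of_le_succ fun n => by
    have := abs_le.1 (h (n + N) (by omega))
    rw [show n + 1 + N = n + N + 1 by omega]
    linarith
  have h2 : Antitone fun n => g (n + N) + B (n + N) := antitone_nat_of_succ_le fun n => by
    have := abs_le.1 (h (n + N) (by omega))
    rw [show n + 1 + N = n + N + 1 by omega]
    linarith
  have hB' : Tendsto (fun n => B (n + N)) atTop (nhds 0) := hB.comp (tendsto_add_atTop_nat N)
  have hB0 : ∀ n, 0 ≤ B (n + N) := by
    intro n
    have h3 : Antitone fun n => B (n + N) := antitone_nat_of_succ_le fun n => by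
      have := (abs_nonneg _).trans (h (n + N) (by omega))
      rw [show n + 1 + N = n + N + 1 by omega]
      linarith
    exact h3.le_of_tendsto hB' n
  have hbdd : BddAbove (Set.range fun n => g (n + N) - B (n + N)) := by
    refine ⟨g (0 + N) + B (0 + N), ?_⟩
    rintro _ ⟨n, rfl⟩
    have := h2 (Nat.zero_le n)
    have := hB0 n
    simp only at *
    linarith
  have t1 := tendsto_atTop_ciSup h1 hbdd
  set c := ⨆ n, (g (n + N) - B (n + N)) with hc
  have t2 : Tendsto (fun n => g (n + N) + B (n + N)) atTop (nhds c) := by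
    have := t1.add (hB'.const_mul 2)
    rw [mul_zero, add_zero] at this
    refine this.congr fun n => ?_
    ring
  refine ⟨c, fun M hM => ?_⟩
  have a1 := h1.ge_of_tendsto t1 (M - N)
  have a2 := h2.le_of_tendsto t2 (M - N)
  simp only [Nat.sub_add_cancel hM] at a1 a2
  exact abs_le.2 ⟨by linarith, by linarith⟩

theorem tendsto_log_pow_div (J : ℕ) :
    Tendsto (fun M : ℕ => Real.log M ^ J / (M : ℝ)) atTop (nhds 0) := by
  have h := (isLittleO_log_rpow_rpow_atTop (J : ℝ) (s := 1) one_pos).tendsto_div_nhds_zero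
  simp only [Real.rpow_natCast, Real.rpow_one] at h
  exact h.comp tendsto_natCast_atTop_atTop

theorem IsLogSmall.tendsto_zero {f : ℕ → ℝ} (h : IsLogSmall 1 f) : Tendsto f atTop (nhds 0) := by
  obtain ⟨J, hJ⟩ := h
  simp only [pow_one] at hJ
  exact hJ.trans_tendsto (tendsto_log_pow_div J)

theorem IsLogSmall.exists_sub_const {g e : ℕ → ℝ} (he : IsLogSmall 2 e)
    (h : ∀ᶠ M in atTop, g (M + 1) - g M = e (M + 1)) : ∃ c, IsLogSmall 1 fun M => g M - c := by
  obtain ⟨J, hJ⟩ := he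
  obtain ⟨C, hC, hJ⟩ := hJ.exists_pos
  have hall := (h.and ((tendsto_add_atTop_nat 1).eventually hJ.bound)).and
    ((eventually_log_pow_div_sq_le J).and (eventually_ge_atTop 1))
  obtain ⟨N, hN⟩ := eventually_atTop.1 hall
  obtain ⟨c, hc⟩ := exists_abs_sub_le_of_abs_sub_le (g := g) (N := N)
    (B := fun M => 2 * C * (Real.log M ^ J / (M : ℝ)))
    (by simpa using (tendsto_log_pow_div J).const_mul (2 * C)) (by
      intro M hM
      obtain ⟨⟨h1, h2⟩, h3, h4⟩ := hN M hM
      have h0 : 0 ≤ Real.log (M + 1 : ℕ) := Real.log_natCast_nonneg _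
      rw [Real.norm_eq_abs, Real.norm_of_nonneg (by positivity)] at h2
      rw [h1]
      refine h2.trans ((mul_le_mul_of_nonneg_left h3 hC.le).trans_eq ?_)
      ring)
  refine ⟨c, J, IsBigO.of_bound (2 * C) ?_⟩
  filter_upwards [eventually_ge_atTop N] with M hM
  have h0 : 0 ≤ Real.log M := Real.log_natCast_nonneg _
  rw [Real.norm_eq_abs, Real.norm_of_nonneg (by positivity), pow_one]
  exact hc M hM

/-! ### Polynomial expansions in log M -/

/-- `f M = P (log M + γ) + O((log M)^J / M)` for some `J`. -/
def HasLogExpansion (f : ℕ → ℝ) (P : ℝ[X]) : Prop :=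
  IsLogSmall 1 fun M => f M - P.eval (Real.log M + Real.eulerMascheroniConstant)

theorem isSchurRegularization_iff (lam : YoungDiagram) (k : ℕ × ℕ → ℕ) (P : ℝ[X]) :
    IsSchurRegularization lam k P ↔ HasLogExpansion (fun M => schurZetaTrunc M lam k) P := by
  simp only [IsSchurRegularization, HasLogExpansion, IsLogSmall, pow_one]
  constructor
  · rintro ⟨J, _, h⟩
    exact ⟨J, h⟩
  · rintro ⟨J, h⟩
    exact ⟨J + 1, J.succ_pos, h.trans (by simpa using isBigO_log_pow_div (Nat.le_succ J) 1)⟩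

namespace HasLogExpansion

variable {f g : ℕ → ℝ} {P Q : ℝ[X]}

theorem isLogSmall_argument :
    IsLogSmall 0 fun M => Real.log M + Real.eulerMascheroniConstant :=
  IsLogSmall.log.add (IsLogSmall.const _)

theorem isLogSmall (h : HasLogExpansion f P) : IsLogSmall 0 f := by
  refine ((h.mono zero_le_one).add (isLogSmall_argument.eval P)).congr'
    (Eventually.of_forall fun M => ?_)
  simp

/-- P − Q tends to 0 along log M + γ → ∞, which a nonconstant polynomial cannot do. -/
theorem unique (hP : HasLogExpansion f P) (hQ : HasLogExpansion f Q) : P = Q := by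
  have h : Tendsto (fun M : ℕ => (P - Q).eval (Real.log M + Real.eulerMascheroniConstant))
      atTop (nhds 0) := by
    refine ((hQ.sub hP).tendsto_zero).congr fun M => ?_
    simp
  have hu : Tendsto (fun M : ℕ => Real.log M + Real.eulerMascheroniConstant) atTop atTop :=
    tendsto_atTop_add_const_right _ _ (Real.tendsto_log_atTop.comp tendsto_natCast_atTop_atTop)
  rcases lt_or_ge 0 (P - Q).degree with hd | hd
  · have := ((P - Q).abs_tendsto_atTop hd).comp hu
    exact absurd h.abs (not_tendsto_nhds_of_tendsto_atTop this _)
  · rw [eq_C_of_degree_le_zero hd] at h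
    simp only [eval_C] at h
    have h0 := tendsto_nhds_unique h tendsto_const_nhds
    rw [← sub_eq_zero, eq_C_of_degree_le_zero hd]
    have h0' : (P - Q).coeff 0 = 0 := tendsto_nhds_unique tendsto_const_nhds h
    rw [h0', C_0]

theorem const (c : ℝ) : HasLogExpansion (fun _ => c) (C c) := by
  simpa [HasLogExpansion] using IsLogSmall.zero 1

theorem add (hf : HasLogExpansion f P) (hg : HasLogExpansion g Q) :
    HasLogExpansion (fun M => f M + g M) (P + Q) := by
  refine (IsLogSmall.add hf hg).congr' (Eventually.of_forall fun M => ?_)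
  simp only [eval_add]
  ring

theorem mul (hf : HasLogExpansion f P) (hg : HasLogExpansion g Q) :
    HasLogExpansion (fun M => f M * g M) (P * Q) := by
  refine ((IsLogSmall.mul (l := 0) hf hg.isLogSmall).add
    (IsLogSmall.mul (k := 0) (isLogSmall_argument.eval P) hg)).congr'
    (Eventually.of_forall fun M => ?_)
  simp only [eval_mul]
  ring

theorem sub (hf : HasLogExpansion f P) (hg : HasLogExpansion g Q) :
    HasLogExpansion (fun M => f M - g M) (P - Q) := by
  refine (IsLogSmall.sub hf hg).congr' (Eventually.of_forall fun M => ?_)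
  simp only [eval_sub]
  ring

theorem sum {ι : Type*} (s : Finset ι) {f : ι → ℕ → ℝ} {P : ι → ℝ[X]}
    (h : ∀ i ∈ s, HasLogExpansion (f i) (P i)) :
    HasLogExpansion (fun M => ∑ i ∈ s, f i M) (∑ i ∈ s, P i) := by
  classical
  induction s using Finset.induction_on with
  | empty => simpa using const 0
  | insert a s ha ih =>
    simp_rw [Finset.sum_insert ha]
    exact (h a (by simp)).add (ih fun i hi => h i (by simp [hi]))

theorem prod {ι : Type*} (s : Finset ι) {f : ι → ℕ → ℝ} {P : ι → ℝ[X]}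
    (h : ∀ i ∈ s, HasLogExpansion (f i) (P i)) :
    HasLogExpansion (fun M => ∏ i ∈ s, f i M) (∏ i ∈ s, P i) := by
  classical
  induction s using Finset.induction_on with
  | empty => simpa using const 1
  | insert a s ha ih =>
    simp_rw [Finset.prod_insert ha]
    exact (h a (by simp)).mul (ih fun i hi => h i (by simp [hi]))

theorem det {n : Type*} [Fintype n] [DecidableEq n] {A : ℕ → Matrix n n ℝ} {B : Matrix n n ℝ[X]}
    (h : ∀ i j, HasLogExpansion (fun M => A M i j) (B i j)) :
    HasLogExpansion (fun M => (A M).det) B.det := by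
  simp_rw [Matrix.det_apply']
  refine sum _ fun σ _ => ?_
  have hσ : ((Equiv.Perm.sign σ : ℤ) : ℝ[X]) = C ((Equiv.Perm.sign σ : ℤ) : ℝ) := by simp
  rw [hσ]
  exact (const _).mul (prod _ fun i _ => h _ _)

/-- Summation against `t⁻ᵃ` preserves the class of sequences with an expansion in `log M`. -/
theorem exists_of_sub_eq {F : ℕ → ℝ} {a : ℕ} (ha : 0 < a) (hf : HasLogExpansion f P)
    (h : ∀ M, F (M + 1) - F M = (((M + 1 : ℕ) : ℝ) ^ a)⁻¹ * f (M + 1)) :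
    ∃ Q, HasLogExpansion F Q := by
  rcases Nat.lt_or_ge 1 a with ha1 | ha1
  -- For a ≥ 2 the increments are O(log^J M / M²), so `F` converges and its polynomial is constant.
  · have he : IsLogSmall 2 fun M => ((M : ℝ) ^ a)⁻¹ * f M :=
      ((IsLogSmall.inv_pow a).mono ha1).mul (l := 0) hf.isLogSmall
    obtain ⟨c, hc⟩ := he.exists_sub_const (Eventually.of_forall h)
    exact ⟨C c, by simpa [HasLogExpansion] using hc⟩
  · obtain rfl : a = 1 := by omega
    obtain ⟨Q, rfl⟩ : ∃ Q : ℝ[X], derivative Q = P := by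
      clear hf
      induction P using Polynomial.induction_on' with
      | add P P' hP hP' =>
        obtain ⟨Q, rfl⟩ := hP
        obtain ⟨Q', rfl⟩ := hP'
        exact ⟨Q + Q', derivative_add⟩
      | monomial n b =>
        refine ⟨monomial (n + 1) (b / (n + 1)), ?_⟩
        rw [derivative_monomial]
        simp only [Nat.add_sub_cancel, Nat.cast_add, Nat.cast_one]
        rw [div_mul_cancel₀ _ (by positivity)]
    -- For a = 1 the polynomial is an antiderivative Q of P, up to a constant. With u = log M + γ
    -- and h = log M − log(M − 1), the increment of F − Q(u) is (f − P(u))/M − (h − 1/M)·P(u) minus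
    -- the Taylor remainder of Q; all three are of second order.
    have he := ((IsLogSmall.mul (IsLogSmall.inv_pow 1) hf).sub
      (IsLogSmall.log_sub_log_sub_inv.mul (l := 0) (isLogSmall_argument.eval (derivative Q)))).sub
      (isLogSmall_argument.eval_sub_eval_sub IsLogSmall.log_sub_log Q)
    obtain ⟨c, hc⟩ := he.exists_sub_const
      (g := fun M => F M - Q.eval (Real.log M + Real.eulerMascheroniConstant))
      (Eventually.of_forall fun M => by
        have e : Real.log ((M + 1 : ℕ) : ℝ) + Real.eulerMascheroniConstant -
          (Real.log ((M + 1 : ℕ) : ℝ) - Real.log (((M + 1 : ℕ) : ℝ) - 1)) =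
          Real.log M + Real.eulerMascheroniConstant := by
            push_cast
            rw [add_sub_cancel_right]
            ring
        rw [e]
        have := h M
        rw [sub_sub_sub_comm, this]
        simp only [pow_one]
        ring)
    refine ⟨Q + C c, hc.congr' (Eventually.of_forall fun M => ?_)⟩
    simp only [eval_add, eval_C]
    ring

end HasLogExpansion

/-! ### Passage to regularized rectangles -/

/-- The recursion for `rowSum`, read as a difference equation in M, reduces the right end `j + 1` to
`j`. -/
theorem exists_hasLogExpansion_rowSum (a : ℕ → ℕ) (ha : ∀ c, 0 < a c) (i j : ℕ) :
    ∃ P, HasLogExpansion (fun M => rowSum (fun t c => ((t : ℝ) ^ a c)⁻¹) M i j) P := by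
  induction j with
  | zero =>
    refine ⟨C (if i = 0 then 1 else 0), ?_⟩
    simp_rw [rowSum_of_le _ _ (Nat.zero_le i)]
    exact HasLogExpansion.const _
  | succ j ih =>
    obtain ⟨P, hP⟩ := ih
    refine hP.exists_of_sub_eq (ha j) fun M => ?_
    rw [rowSum]
    ring

theorem jacobiTrudi_rect_desnanot_jacobi {R : Type*} [CommRing R] (x : ℕ → ℕ → R) (M s p q : ℕ)
    (hp : 1 ≤ p) (hq : 1 ≤ q) :
    (jacobiTrudi x M s fun _ : Fin p => q + 1).det *
        (jacobiTrudi x M (s + 1) fun _ : Fin p => q - 1).det =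
      (jacobiTrudi x M s fun _ : Fin p => q).det *
          (jacobiTrudi x M (s + 1) fun _ : Fin p => q).det -
        (jacobiTrudi x M (s + 1) fun _ : Fin (p - 1) => q).det *
          (jacobiTrudi x M s fun _ : Fin (p + 1) => q).det := by
  obtain ⟨p, rfl⟩ := Nat.exists_eq_add_of_le' hp
  obtain ⟨q, rfl⟩ := Nat.exists_eq_add_of_le' hq
  rw [Nat.add_sub_cancel, Nat.add_sub_cancel]
  set A := jacobiTrudi x M s fun _ : Fin (p + 1 + 1) => q + 1 with hA
  have h := A.desnanot_jacobi
  have e1 : A.submatrix (fun i : Fin p => i.castSucc.succ) (fun i => i.castSucc.succ) =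
      jacobiTrudi x M (s + 1) fun _ : Fin p => q + 1 := by
    ext i j
    simp only [hA, jacobiTrudi, Matrix.submatrix_apply, Matrix.of_apply, Fin.val_succ,
      Fin.val_castSucc]
    congr 1 <;> omega
  have e2 : A.submatrix Fin.succ Fin.succ =
      jacobiTrudi x M (s + 1) fun _ : Fin (p + 1) => q + 1 := by
    ext i j
    simp only [hA, jacobiTrudi, Matrix.submatrix_apply, Matrix.of_apply, Fin.val_succ]
    congr 1 <;> omega
  have e3 : A.submatrix Fin.castSucc Fin.castSucc =
      jacobiTrudi x M s fun _ : Fin (p + 1) => q + 1 := rfl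
  have e4 : A.submatrix Fin.succ Fin.castSucc =
      jacobiTrudi x M (s + 1) fun _ : Fin (p + 1) => q := by
    ext i j
    simp only [hA, jacobiTrudi, Matrix.submatrix_apply, Matrix.of_apply, Fin.val_succ,
      Fin.val_castSucc]
    congr 1 <;> omega
  have e5 : A.submatrix Fin.castSucc Fin.succ =
      jacobiTrudi x M s fun _ : Fin (p + 1) => q + 1 + 1 := by
    ext i j
    simp only [hA, jacobiTrudi, Matrix.submatrix_apply, Matrix.of_apply, Fin.val_succ,
      Fin.val_castSucc]
    congr 1 <;> omega
  rw [e1, e2, e3, e4, e5] at h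
  linear_combination h

theorem det_jacobiTrudi_const_zero {R : Type*} [CommRing R] (x : ℕ → ℕ → R) (M s p : ℕ) :
    (jacobiTrudi x M s fun _ : Fin p => 0).det = 1 := by
  rw [Matrix.det_of_isUpperTriangular]
  · refine Finset.prod_eq_one fun i _ => ?_
    simp [jacobiTrudi, rowSum_of_le]
  · intro i j hij
    have hij' : (j : ℕ) < i := hij
    simp only [jacobiTrudi, Matrix.of_apply]
    rw [rowSum_of_le _ _ (by omega), if_neg (by omega)]

/-- The truncated Jacobi–Trudi determinant of a rectangle with contents `b + s, b + s + 1, …` in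
its lowest row. -/
noncomputable def rectDet (a : ℤ → ℕ) (b : ℤ) (M s p q : ℕ) : ℝ :=
  (jacobiTrudi (fun t c => ((t : ℝ) ^ a (b + c))⁻¹) M s fun _ : Fin p => q).det

theorem schurZetaTrunc_eq_rectDet {a : ℤ → ℕ} {m b : ℤ} {s p : ℕ} (h : b + s = m - p + 1)
    (M q : ℕ) :
    schurZetaTrunc M (rectDiagram p q) (diagTableau (shiftSeq m a)) = rectDet a b M s p q := by
  refine schurZetaTrunc_rect M p q s _ (fun c => a (b + c)) fun i j hi _ => ?_
  simp only [diagTableau, shiftSeq]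
  congr 1
  have : p - 1 - i + 1 + i = p := by omega
  have h' : ((p - 1 - i : ℕ) : ℤ) + 1 + i = p := by exact_mod_cast this
  push_cast
  linarith

theorem exists_hasLogExpansion_rectDet {a : ℤ → ℕ} (ha : ∀ c, 0 < a c) (b : ℤ) (s p q : ℕ) :
    ∃ P, HasLogExpansion (fun M => rectDet a b M s p q) P := by
  choose P hP using fun i j => exists_hasLogExpansion_rowSum (fun c : ℕ => a (b + c))
    (fun _ => ha _) i j
  exact ⟨_, HasLogExpansion.det (B := Matrix.of fun k k' : Fin p => P (s + k) (s + k' + q))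
    fun _ _ => hP _ _⟩

theorem existsUnique_isSchurRegularization_rect {a : ℤ → ℕ} (ha : ∀ c, 0 < a c) (m : ℤ)
    (p q : ℕ) :
    ∃! P : ℝ[X], IsSchurRegularization (rectDiagram p q) (diagTableau (shiftSeq m a)) P := by
  obtain ⟨P, hP⟩ := exists_hasLogExpansion_rectDet ha (m - p + 1) 0 p q
  simp_rw [isSchurRegularization_iff,
    schurZetaTrunc_eq_rectDet (a := a) (m := m) (b := m - p + 1) (s := 0) (p := p) (by simp)]
  exact ⟨P, hP, fun Q hQ => HasLogExpansion.unique hQ hP⟩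

theorem threeSeq_pos {α β γ : ℕ} (hα : 0 < α) (hβ : 0 < β) (hγ : 0 < γ) (c : ℤ) :
    0 < threeSeq α β γ c := by
  unfold threeSeq
  split_ifs <;> assumption

theorem IsSchurRegularization.schurRegPoly_eq {lam : YoungDiagram}
    {k : ℕ × ℕ → ℕ} {P : ℝ[X]} (h : IsSchurRegularization lam k P) : schurRegPoly lam k = P := by
  have hex : ∃ P : ℝ[X], IsSchurRegularization lam k P := ⟨P, h⟩
  rw [schurRegPoly, dif_pos hex]
  exact ((isSchurRegularization_iff _ _ _).1 hex.choose_spec).unique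
    ((isSchurRegularization_iff _ _ _).1 h)

/-- The bottom left box has content m − p + 1. The convention `rectReg = 1` for p = 0 or q = 0
agrees with the determinant, which is then empty or unitriangular. -/
theorem rectReg_eq_eval {α β γ : ℕ} {m b : ℤ} {s p q : ℕ} (h : b + s = m - p + 1) {P : ℝ[X]}
    (hP : HasLogExpansion (fun M => rectDet (threeSeq α β γ) b M s p q) P) :
    rectReg α β γ m p q = P.eval 0 := by
  rw [rectReg]
  split_ifs with h0
  · have h1 : ∀ M, rectDet (threeSeq α β γ) b M s p q = 1 := by
      intro M
      rcases h0 with rfl | rfl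
      · simp [rectDet]
      · exact det_jacobiTrudi_const_zero _ _ _ _
    simp_rw [h1] at hP
    rw [hP.unique (HasLogExpansion.const 1), eval_C]
  · rw [schurZetaReg, IsSchurRegularization.schurRegPoly_eq]
    rw [isSchurRegularization_iff]
    simpa only [schurZetaTrunc_eq_rectDet h] using hP

theorem mainTheorem10 (α β γ : ℕ) (hα : 0 < α) (hβ : 0 < β) (hγ : 0 < γ) :
    (∀ (m : ℤ) (p q : ℕ), 1 ≤ p → 1 ≤ q →
      ∃! P : ℝ[X], IsSchurRegularization (rectDiagram p q)
        (diagTableau (shiftSeq m (threeSeq α β γ))) P) ∧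
    (∀ (m : ℤ) (p q : ℕ), 1 ≤ p → 1 ≤ q →
      rectReg α β γ m p (q + 1) * rectReg α β γ (m + 1) p (q - 1) =
        rectReg α β γ m p q * rectReg α β γ (m + 1) p q -
          rectReg α β γ m (p - 1) q * rectReg α β γ (m + 1) (p + 1) q) := by
  have ha := threeSeq_pos hα hβ hγ
  refine ⟨fun m p q _ _ => existsUnique_isSchurRegularization_rect ha m p q,
    fun m p q hp hq => ?_⟩
  -- One base content serves all six rectangles: their lowest rows start at m − p + 1 (offset 0) or
  -- at m − p + 2 (offset 1).
  choose P hP using exists_hasLogExpansion_rectDet ha (m - p + 1)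
  have hp' : ((p - 1 : ℕ) : ℤ) = p - 1 := by push_cast [hp]; ring
  rw [rectReg_eq_eval (by simp) (hP 0 p (q + 1)),
    rectReg_eq_eval (by push_cast; ring) (hP 1 p (q - 1)),
    rectReg_eq_eval (by simp) (hP 0 p q), rectReg_eq_eval (by push_cast; ring) (hP 1 p q),
    rectReg_eq_eval (by rw [hp']; push_cast; ring) (hP 1 (p - 1) q),
    rectReg_eq_eval (by push_cast; ring) (hP 0 (p + 1) q),
    ← eval_mul, ← eval_mul, ← eval_mul, ← eval_sub]
  congr 1
  -- The identity is proved for the polynomials themselves: both sides expand the same truncated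
  -- sequence.
  refine ((hP 0 p (q + 1)).mul (hP 1 p (q - 1))).unique ?_
  have h := ((hP 0 p q).mul (hP 1 p q)).sub ((hP 1 (p - 1) q).mul (hP 0 (p + 1) q))
  refine h.congr' (Eventually.of_forall fun M => ?_)
  simp only [rectDet]
  rw [jacobiTrudi_rect_desnanot_jacobi _ M 0 p q hp hq]
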